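/- All sets and monoids are small; $\mathbf{Set}$ is the category of small sets. For a monoid $M$, regarded as a category with one object, $[M^{\mathrm{op}},\mathbf{Set}]$ is the category of right $M$-sets. Let $\mathbf{Mon}_s$ be the 2-category whose objects are monoids and whose 1-cells $M'\to M$ are semigroup homomorphisms (not required to preserve the identity). A 2-cell $f\Rightarrow g$ between $f,g:M'\to M$ is a conjugation, i.e. an element $\alpha\in M$ with $\alpha f(1)=\alpha=g(1)\alpha$ and $\alpha f(m')=g(m')\alpha$ for all $m'\in M'$. Vertical composition is multiplication in $M$, the identity 2-cell of $f$ is $f(1)$, and the horizontal composite of $\alpha:f\Rightarrow g:M'\to M$ and $\beta:h\Rightarrow k:M\to N$ is $\beta\, h(\alpha)=k(\alpha)\,\beta$. Let $\mathbf{Mon}_s^{\mathrm{co}}$ be obtained from $\mathbf{Mon}_s$ by reversing the 2-cells. A geometric morphism $\phi:\mathcal E\to\mathcal F$ consists of a functor $\phi_*:\mathcal E\to\mathcal F$ with a left adjoint $\phi^*$ preserving finite limits; it is essential if $\phi^*$ has a further left adjoint, and surjective if $\phi^*$ is comonadic. Let $\mathbf{TOP}^*_{\mathrm{ess}}$ be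 the 2-category whose objects are the Grothendieck toposes $\mathcal E$ admitting an essential surjective point, i.e. an essential surjective geometric morphism $\mathbf{Set}\to\mathcal E$ (which is not part of the data), whose 1-cells are the essential geometric morphisms, and whose 2-cells $\phi\Rightarrow\psi$ are the natural transformations $\phi^*\Rightarrow\psi^*$. Each semigroup homomorphism $f:M'\to M$ induces an essential geometric morphism $[M'^{\mathrm{op}},\mathbf{Set}]\to[M^{\mathrm{op}},\mathbf{Set}]$ whose inverse image sends a right $M$-set $X$ to $Xf(1)=\{x\in X: x f(1)=x\}$, with $m'\in M'$ acting as $f(m')$. Each conjugation $\alpha:f\Rightarrow g$ induces the natural transformation $Xg(1)\to Xf(1)$, $x\mapsto x\alpha$, between the inverse images. **Theorem.** With this action on 1-cells and 2-cells, the assignment $M\mapsto[M^{\mathrm{op}},\mathbf{Set}]$ is a pseudofunctor $\mathbf{Mon}_s^{\mathrm{co}}\to\mathbf{TOP}^*_{\mathrm{ess}}$, and it is a 2-equivalence: every object of $\mathbf{TOP}^*_{\mathrm{ess}}$ is equivalent, in that 2-category, to $[M^{\mathrm{op}},\mathbf{Set}]$ for some monoid $M$, and for all monoids $M',M$ the induced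 functor $$\mathbf{Mon}_s^{\mathrm{co}}(M',M)\to\mathbf{TOP}^*_{\mathrm{ess}}\bigl([M'^{\mathrm{op}},\mathbf{Set}],[M^{\mathrm{op}},\mathbf{Set}]\bigr)$$ is an equivalence of categories. -/

import Mathlib

universe w v u

namespace MonoidTopos

open CategoryTheory Bicategory Opposite Limits

/-! ### The 2-cell dual of a bicategory -/

/-- The 2-cell dual `Bᶜᵒ` of a bicategory `B`: same objects, same 1-cells, reversed 2-cells. -/
structure Co (B : Type u) where
  /-- The underlying object of `B`. -/
  of : B

namespace Co

variable {B : Type u} [Bicategory.{w, v} B]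

/-- The 1-cells of `Co B` are those of `B`. -/
structure Hom (a b : Co B) where
  /-- The underlying 1-cell of `B`. -/
  of : a.of ⟶ b.of

instance : CategoryStruct (Co B) where
  Hom a b := Hom a b
  id a := ⟨𝟙 a.of⟩
  comp f g := ⟨f.of ≫ g.of⟩

/-- The 2-cells `f ⟶ g` of `Co B` are the 2-cells `g ⟶ f` of `B`. -/
@[ext]
structure Hom₂ {a b : Co B} (f g : a ⟶ b) where
  /-- The underlying 2-cell of `B`, in the reversed direction. -/
  of : Hom.of g ⟶ Hom.of f

instance (a b : Co B) : Category (a ⟶ b) where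
  Hom f g := Hom₂ f g
  id f := ⟨𝟙 (Hom.of f)⟩
  comp η θ := ⟨Hom₂.of θ ≫ Hom₂.of η⟩

@[ext] lemma hom₂_ext {a b : Co B} {f g : a ⟶ b} {η θ : f ⟶ g}
    (h : Hom₂.of η = Hom₂.of θ) : η = θ := Hom₂.ext h

@[simp] lemma id_of (a : Co B) : Hom.of (𝟙 a) = 𝟙 a.of := rfl

@[simp] lemma comp_of {a b c : Co B} (f : a ⟶ b) (g : b ⟶ c) :
    Hom.of (f ≫ g) = Hom.of f ≫ Hom.of g := rfl

@[simp] lemma id₂_of {a b : Co B} (f : a ⟶ b) : Hom₂.of (𝟙 f) = 𝟙 (Hom.of f) := rfl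

@[simp] lemma comp₂_of {a b : Co B} {f g h : a ⟶ b} (η : f ⟶ g) (θ : g ⟶ h) :
    Hom₂.of (η ≫ θ) = Hom₂.of θ ≫ Hom₂.of η := rfl

/-- An invertible 2-cell of `B`, seen in `Co B`. -/
@[simps]
def isoMk {a b : Co B} {f g : a ⟶ b} (e : Hom.of f ≅ Hom.of g) : f ≅ g where
  hom := ⟨e.inv⟩
  inv := ⟨e.hom⟩
  hom_inv_id := Hom₂.ext e.hom_inv_id
  inv_hom_id := Hom₂.ext e.inv_hom_id

/-- Left whiskering in `Co B` is that of `B`. -/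
@[simps]
def whiskerLeft {a b c : Co B} (f : a ⟶ b) {g h : b ⟶ c} (η : Hom₂ g h) :
    Hom₂ (f ≫ g) (f ≫ h) where
  of := Hom.of f ◁ η.of

/-- Right whiskering in `Co B` is that of `B`. -/
@[simps]
def whiskerRight {a b c : Co B} {f g : a ⟶ b} (η : Hom₂ f g) (h : b ⟶ c) :
    Hom₂ (f ≫ h) (g ≫ h) where
  of := η.of ▷ Hom.of h

instance : Bicategory (Co B) where
  whiskerLeft f _ _ η := whiskerLeft f η
  whiskerRight η h := whiskerRight η h
  associator f g h := isoMk (α_ (Hom.of f) (Hom.of g) (Hom.of h))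
  leftUnitor f := isoMk (λ_ (Hom.of f))
  rightUnitor f := isoMk (ρ_ (Hom.of f))
  whiskerLeft_id f g := by ext; simp
  whiskerLeft_comp f _ _ _ η θ := by ext; simp
  id_whiskerLeft η := by ext; simp
  comp_whiskerLeft f g _ _ η := by ext; simp
  id_whiskerRight f g := by ext; simp
  comp_whiskerRight η θ i := by ext; simp
  whiskerRight_id η := by ext; simp
  whiskerRight_comp η g h := by ext; simp
  whisker_assoc f _ _ η h := by ext; simp
  whisker_exchange η θ := by ext; simp [whisker_exchange]
  pentagon f g h i := by ext; simp
  triangle f g := by ext; simp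

end Co

/-! ### Biequivalences -/

/-- A pseudofunctor is a 2-equivalence (biequivalence) if it is essentially surjective up to
internal equivalence on objects, and an equivalence of categories on every hom-category. -/
structure IsTwoEquivalence {B : Type*} [Bicategory B] {C : Type*} [Bicategory C]
    (F : B ⥤ᵖ C) : Prop where
  essSurj (c : C) : ∃ b : B, Nonempty (Bicategory.Equivalence (F.obj b) c)
  isEquivalence_mapFunctor (a b : B) :
    (F.toPrelaxFunctor.mapFunctor a b).IsEquivalence

/-! ### The 2-category of monoids, semigroup homomorphisms and conjugations -/

/-- Objects: small monoids. -/
structure MonS where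
  /-- The underlying type. -/
  carrier : Type u
  [monoid : Monoid carrier]

namespace MonS

instance : CoeSort MonS.{u} (Type u) := ⟨MonS.carrier⟩

instance (M : MonS.{u}) : Monoid M := M.monoid

/-- 1-cells: semigroup homomorphisms (which need not preserve `1`). -/
structure Hom (M N : MonS.{u}) where
  /-- The underlying semigroup homomorphism. -/
  hom : M →ₙ* N

instance : CategoryStruct MonS.{u} where
  Hom M N := Hom M N
  id M := ⟨MulHom.id M⟩
  comp f g := ⟨g.hom.comp f.hom⟩

/-- 2-cells: a conjugation `α : f ⇒ g` is an element `α` of the codomain with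
`α f(1) = α = g(1) α` and `α f(m) = g(m) α` for all `m`. -/
@[ext]
structure Conjugation {M N : MonS.{u}} (f g : M ⟶ N) where
  /-- The underlying element of the codomain. -/
  elt : N
  elt_mul : elt * Hom.hom f 1 = elt
  mul_elt : Hom.hom g 1 * elt = elt
  comm (m : M) : elt * Hom.hom f m = Hom.hom g m * elt

attribute [simp] Conjugation.elt_mul Conjugation.mul_elt

/-- Vertical composition is multiplication in the codomain; the identity of `f` is `f 1`. -/
instance (M N : MonS.{u}) : Category (M ⟶ N) where
  Hom f g := Conjugation f g
  id f :=
    { elt := Hom.hom f 1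
      elt_mul := by rw [← map_mul, mul_one]
      mul_elt := by rw [← map_mul, mul_one]
      comm := fun m => by rw [← map_mul, ← map_mul, mul_one, one_mul] }
  comp {f g h} α β :=
    { elt := Conjugation.elt β * Conjugation.elt α
      elt_mul := by rw [mul_assoc, Conjugation.elt_mul]
      mul_elt := by rw [← mul_assoc, Conjugation.mul_elt]
      comm := fun m => by
        rw [mul_assoc, Conjugation.comm, ← mul_assoc, Conjugation.comm, mul_assoc] }
  id_comp α := Conjugation.ext (Conjugation.elt_mul α)
  comp_id α := Conjugation.ext (Conjugation.mul_elt α)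
  assoc α β γ := Conjugation.ext (mul_assoc _ _ _).symm

@[ext] lemma hom₂_ext {M N : MonS.{u}} {f g : M ⟶ N} {α β : f ⟶ g}
    (h : Conjugation.elt α = Conjugation.elt β) : α = β :=
  Conjugation.ext h

@[simp] lemma id_hom_apply (M : MonS.{u}) (m : M) : Hom.hom (𝟙 M) m = m := rfl

@[simp] lemma comp_hom_apply {M N K : MonS.{u}} (f : M ⟶ N) (g : N ⟶ K) (m : M) :
    Hom.hom (f ≫ g) m = Hom.hom g (Hom.hom f m) := rfl

@[simp] lemma id_elt {M N : MonS.{u}} (f : M ⟶ N) :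
    Conjugation.elt (𝟙 f) = Hom.hom f 1 := rfl

@[simp] lemma comp_elt {M N : MonS.{u}} {f g h : M ⟶ N} (α : f ⟶ g) (β : g ⟶ h) :
    Conjugation.elt (α ≫ β) = Conjugation.elt β * Conjugation.elt α := rfl

/-- The horizontal composite of the identity of `h` with `α`. -/
@[simps]
def whiskerLeft {K M N : MonS.{u}} (h : K ⟶ M) {f g : M ⟶ N} (α : Conjugation f g) :
    Conjugation (h ≫ f) (h ≫ g) where
  elt := α.elt * Hom.hom f (Hom.hom h 1)
  elt_mul := by rw [comp_hom_apply, mul_assoc, ← map_mul, ← map_mul, mul_one]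
  mul_elt := by
    rw [comp_hom_apply, α.comm, ← mul_assoc, ← map_mul, ← map_mul, mul_one]
  comm m := by
    rw [comp_hom_apply, comp_hom_apply, mul_assoc, ← map_mul, ← map_mul, one_mul, α.comm,
      α.comm, ← mul_assoc, ← map_mul, ← map_mul, mul_one]

/-- The horizontal composite of `α` with the identity of `h`. -/
@[simps]
def whiskerRight {M N K : MonS.{u}} {f g : M ⟶ N} (α : Conjugation f g) (h : N ⟶ K) :
    Conjugation (f ≫ h) (g ≫ h) where
  elt := Hom.hom h α.elt
  elt_mul := by rw [comp_hom_apply, ← map_mul, α.elt_mul]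
  mul_elt := by rw [comp_hom_apply, ← map_mul, α.mul_elt]
  comm m := by rw [comp_hom_apply, comp_hom_apply, ← map_mul, ← map_mul, α.comm]

/-- Composition of 1-cells is strictly associative and unital. -/
instance : Bicategory MonS.{u} where
  whiskerLeft h _ _ α := whiskerLeft h α
  whiskerRight α h := whiskerRight α h
  associator f g h := Iso.refl (f ≫ g ≫ h)
  leftUnitor f := Iso.refl f
  rightUnitor f := Iso.refl f
  whiskerLeft_id f g := by
    ext
    simp [← map_mul]
  whiskerLeft_comp f _ _ _ η θ := by
    ext
    simp only [whiskerLeft_elt, comp_elt]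
    rw [mul_assoc, mul_assoc θ.elt, ← mul_assoc (Hom.hom _ _) η.elt, ← η.comm, mul_assoc η.elt,
      ← map_mul, ← map_mul, mul_one]
  id_whiskerLeft η := by
    ext
    simp
  comp_whiskerLeft f g _ _ η := by
    ext
    simp [mul_assoc, ← map_mul]
  id_whiskerRight f g := by
    ext
    simp
  comp_whiskerRight η θ i := by
    ext
    simp
  whiskerRight_id η := by
    ext
    simp
  whiskerRight_comp η g h := by
    ext
    simp [← map_mul]
  whisker_assoc f _ _ η h := by
    ext
    simp [mul_assoc, ← map_mul]
  whisker_exchange η θ := by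
    ext
    simp only [whiskerLeft_elt, whiskerRight_elt, comp_elt]
    rw [← mul_assoc, ← θ.comm, mul_assoc, mul_assoc, ← map_mul, ← map_mul, η.elt_mul, η.mul_elt]
  pentagon f g h i := by
    ext
    simp [← map_mul]
  triangle f g := by
    ext
    simp [← map_mul]

end MonS

/-! ### The 2-category of toposes with an essential surjective point -/

section

universe v₁ v₂ v₃ v₄ u₁ u₂ u₃ u₄

/-- A geometric morphism `E ⟶ F`. -/
structure GeometricMorphism (E : Type u₁) [Category.{v₁} E] (F : Type u₂) [Category.{v₂} F] where
  /-- The direct image functor. -/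
  directImage : E ⥤ F
  /-- The inverse image functor. -/
  inverseImage : F ⥤ E
  /-- The inverse image is left adjoint to the direct image. -/
  adj : inverseImage ⊣ directImage
  preservesFiniteLimits : PreservesFiniteLimits inverseImage

namespace GeometricMorphism

variable {E : Type u₁} [Category.{v₁} E] {F : Type u₂} [Category.{v₂} F]
  {G : Type u₃} [Category.{v₃} G]

/-- A geometric morphism is essential if its inverse image has a further left adjoint. -/
def IsEssential (φ : GeometricMorphism E F) : Prop := φ.inverseImage.IsRightAdjoint

/-- A geometric morphism is surjective if its inverse image is comonadic. -/
def IsSurjective (φ : GeometricMorphism E F) : Prop :=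
  Nonempty (ComonadicLeftAdjoint φ.inverseImage)

variable (E) in
/-- The identity geometric morphism. -/
@[simps]
def id : GeometricMorphism E E where
  directImage := 𝟭 E
  inverseImage := 𝟭 E
  adj := Adjunction.id
  preservesFiniteLimits := inferInstance

/-- Composition of geometric morphisms. -/
@[simps]
def comp (φ : GeometricMorphism E F) (ψ : GeometricMorphism F G) : GeometricMorphism E G where
  directImage := φ.directImage ⋙ ψ.directImage
  inverseImage := ψ.inverseImage ⋙ φ.inverseImage
  adj := ψ.adj.comp φ.adj
  preservesFiniteLimits :=
    have := φ.preservesFiniteLimits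
    have := ψ.preservesFiniteLimits
    comp_preservesFiniteLimits _ _

lemma isEssential_id : (id E).IsEssential :=
  inferInstanceAs (𝟭 E).IsRightAdjoint

lemma IsEssential.comp {φ : GeometricMorphism E F} {ψ : GeometricMorphism F G}
    (hφ : φ.IsEssential) (hψ : ψ.IsEssential) : (φ.comp ψ).IsEssential :=
  have : φ.inverseImage.IsRightAdjoint := hφ
  have : ψ.inverseImage.IsRightAdjoint := hψ
  inferInstanceAs (ψ.inverseImage ⋙ φ.inverseImage).IsRightAdjoint

end GeometricMorphism

end

/-- `E` is a Grothendieck topos: it is equivalent to the category of sheaves of sets on a small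
site. -/
def IsGrothendieckTopos (E : Type (u + 1)) [Category.{u} E] : Prop :=
  ∃ (C : Type u) (_ : SmallCategory C) (J : GrothendieckTopology C),
    Nonempty (E ≌ Sheaf J (Type u))

/-- Objects: Grothendieck toposes admitting an essential surjective point (which is not part of
the data). -/
structure PointedTopos where
  /-- The underlying category. -/
  carrier : Type (u + 1)
  [category : Category.{u} carrier]
  isGrothendieckTopos : IsGrothendieckTopos carrier
  exists_point : ∃ p : GeometricMorphism (Type u) carrier, p.IsEssential ∧ p.IsSurjective

namespace PointedTopos

instance : CoeSort PointedTopos.{u} (Type (u + 1)) := ⟨PointedTopos.carrier⟩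

instance (E : PointedTopos.{u}) : Category.{u} E := E.category

/-- 1-cells: essential geometric morphisms. -/
structure Hom (E F : PointedTopos.{u}) where
  /-- The underlying geometric morphism. -/
  geom : GeometricMorphism E F
  isEssential : geom.IsEssential

/-- 2-cells: natural transformations between the inverse image functors. -/
@[ext]
structure Hom₂ {E F : PointedTopos.{u}} (φ ψ : Hom E F) where
  /-- The underlying natural transformation. -/
  nat : φ.geom.inverseImage ⟶ ψ.geom.inverseImage

instance : CategoryStruct PointedTopos.{u} where
  Hom E F := Hom E F
  id E := ⟨GeometricMorphism.id E, GeometricMorphism.isEssential_id⟩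
  comp φ ψ := ⟨φ.geom.comp ψ.geom, φ.isEssential.comp ψ.isEssential⟩

instance (E F : PointedTopos.{u}) : Category (E ⟶ F) where
  Hom φ ψ := Hom₂ φ ψ
  id φ := ⟨𝟙 φ.geom.inverseImage⟩
  comp η θ := ⟨η.nat ≫ θ.nat⟩

@[ext] lemma hom₂_ext {E F : PointedTopos.{u}} {φ ψ : E ⟶ F} {η θ : φ ⟶ ψ}
    (h : ∀ X, (Hom₂.nat η).app X = (Hom₂.nat θ).app X) : η = θ :=
  Hom₂.ext (NatTrans.ext (funext h))

@[simp] lemma id_geom (E : PointedTopos.{u}) :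
    Hom.geom (𝟙 E) = GeometricMorphism.id E := rfl

@[simp] lemma comp_geom {E F G : PointedTopos.{u}} (φ : E ⟶ F) (ψ : F ⟶ G) :
    Hom.geom (φ ≫ ψ) = (Hom.geom φ).comp (Hom.geom ψ) := rfl

@[simp] lemma id_nat {E F : PointedTopos.{u}} (φ : E ⟶ F) :
    Hom₂.nat (𝟙 φ) = 𝟙 (Hom.geom φ).inverseImage := rfl

@[simp] lemma comp_nat {E F : PointedTopos.{u}} {φ ψ χ : E ⟶ F} (η : φ ⟶ ψ) (θ : ψ ⟶ χ) :
    Hom₂.nat (η ≫ θ) = Hom₂.nat η ≫ Hom₂.nat θ := rfl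

/-- A natural isomorphism between inverse images is an invertible 2-cell. -/
@[simps]
def isoMk {E F : PointedTopos.{u}} {φ ψ : E ⟶ F}
    (e : (Hom.geom φ).inverseImage ≅ (Hom.geom ψ).inverseImage) : φ ≅ ψ where
  hom := ⟨e.hom⟩
  inv := ⟨e.inv⟩
  hom_inv_id := Hom₂.ext e.hom_inv_id
  inv_hom_id := Hom₂.ext e.inv_hom_id

/-- Whiskering on the left by a geometric morphism. -/
@[simps]
def whiskerLeft {E F G : PointedTopos.{u}} (φ : E ⟶ F) {ψ ψ' : F ⟶ G} (η : Hom₂ ψ ψ') :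
    Hom₂ (φ ≫ ψ) (φ ≫ ψ') where
  nat := Functor.whiskerRight η.nat (Hom.geom φ).inverseImage

/-- Whiskering on the right by a geometric morphism. -/
@[simps]
def whiskerRight {E F G : PointedTopos.{u}} {φ φ' : E ⟶ F} (η : Hom₂ φ φ') (ψ : F ⟶ G) :
    Hom₂ (φ ≫ ψ) (φ' ≫ ψ) where
  nat := Functor.whiskerLeft (Hom.geom ψ).inverseImage η.nat

instance : Bicategory PointedTopos.{u} where
  whiskerLeft φ _ _ η := whiskerLeft φ η
  whiskerRight η ψ := whiskerRight η ψ
  associator φ ψ χ := isoMk (φ := (φ ≫ ψ) ≫ χ) (ψ := φ ≫ ψ ≫ χ)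
    (Functor.associator (Hom.geom χ).inverseImage (Hom.geom ψ).inverseImage
      (Hom.geom φ).inverseImage).symm
  leftUnitor {E F} φ := isoMk (φ := 𝟙 E ≫ φ) (ψ := φ)
    (Functor.rightUnitor (Hom.geom φ).inverseImage)
  rightUnitor {E F} φ := isoMk (φ := φ ≫ 𝟙 F) (ψ := φ)
    (Functor.leftUnitor (Hom.geom φ).inverseImage)
  whiskerLeft_id φ ψ := hom₂_ext fun X => (Hom.geom φ).inverseImage.map_id _
  whiskerLeft_comp φ _ _ _ η θ := hom₂_ext fun X => (Hom.geom φ).inverseImage.map_comp _ _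
  id_whiskerLeft η := hom₂_ext fun X => ((Category.id_comp _).trans (Category.comp_id _)).symm
  comp_whiskerLeft φ ψ _ _ η :=
    hom₂_ext fun X => ((Category.id_comp _).trans (Category.comp_id _)).symm
  id_whiskerRight φ ψ := rfl
  comp_whiskerRight η θ χ := rfl
  whiskerRight_id η := hom₂_ext fun X => ((Category.id_comp _).trans (Category.comp_id _)).symm
  whiskerRight_comp η ψ χ :=
    hom₂_ext fun X => ((Category.id_comp _).trans (Category.comp_id _)).symm
  whisker_assoc φ _ _ η ψ :=
    hom₂_ext fun X => ((Category.id_comp _).trans (Category.comp_id _)).symm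
  whisker_exchange η θ := hom₂_ext fun X => (Hom₂.nat η).naturality _
  pentagon φ ψ χ ω := hom₂_ext fun X =>
    (Category.id_comp _).trans (congrArg (𝟙 _ ≫ ·) ((Hom.geom φ).inverseImage.map_id _))
  triangle φ ψ := hom₂_ext fun X =>
    (Category.id_comp _).trans ((Hom.geom φ).inverseImage.map_id _)

end PointedTopos

/-! ### The toposes of right `M`-sets -/

/-- The category `[Mᵒᵖ, Set]` of right `M`-sets, as presheaves on the one-object category `M`. -/
abbrev RightSets (M : MonS.{u}) : Type (u + 1) := (SingleObj M)ᵒᵖ ⥤ Type u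

namespace RightSets

variable {M N K : MonS.{u}}

/-- The underlying set of a right `M`-set. -/
abbrev pt (X : RightSets M) : Type u := X.obj (op (SingleObj.star M))

/-- The right action `x · m`. -/
def act (X : RightSets M) (x : X.pt) (m : M) : X.pt :=
  X.map (Quiver.Hom.op (X := SingleObj.star M) (Y := SingleObj.star M) m) x

@[simp] lemma act_one (X : RightSets M) (x : X.pt) : X.act x 1 = x :=
  ConcreteCategory.congr_hom (X.map_id (op (SingleObj.star M))) x

lemma act_mul (X : RightSets M) (x : X.pt) (m n : M) :
    X.act x (m * n) = X.act (X.act x m) n :=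
  ConcreteCategory.congr_hom (X.map_comp
    (Quiver.Hom.op (X := SingleObj.star M) (Y := SingleObj.star M) m)
    (Quiver.Hom.op (X := SingleObj.star M) (Y := SingleObj.star M) n)) x

/-- The function underlying a morphism of right `M`-sets. -/
def fn {X Y : RightSets M} (φ : X ⟶ Y) (x : X.pt) : Y.pt := φ.app (op (SingleObj.star M)) x

lemma fn_act {X Y : RightSets M} (φ : X ⟶ Y) (x : X.pt) (m : M) :
    fn φ (X.act x m) = Y.act (fn φ x) m :=
  ConcreteCategory.congr_hom (φ.naturality
    (Quiver.Hom.op (X := SingleObj.star M) (Y := SingleObj.star M) m)) x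

@[simp] lemma fn_id (X : RightSets M) (x : X.pt) : fn (𝟙 X) x = x := rfl

@[simp] lemma fn_comp {X Y Z : RightSets M} (φ : X ⟶ Y) (ψ : Y ⟶ Z) (x : X.pt) :
    fn (φ ≫ ψ) x = fn ψ (fn φ x) := rfl

lemma hom_ext' {X Y : RightSets M} {φ ψ : X ⟶ Y} (h : ∀ x, fn φ x = fn ψ x) : φ = ψ :=
  NatTrans.ext (funext fun _ => ConcreteCategory.hom_ext _ _ h)

/-- The right `M`-set with a given underlying set and action. -/
@[simps]
def ofAction (S : Type u) (a : S → M → S) (one : ∀ x, a x 1 = x)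
    (mul : ∀ x m n, a x (m * n) = a (a x m) n) : RightSets M where
  obj _ := S
  map m := ↾fun x => a x m.unop
  map_id _ := ConcreteCategory.hom_ext _ _ one
  map_comp m n := ConcreteCategory.hom_ext _ _ fun x => mul x m.unop n.unop

/-- An equivariant map is a morphism of right `M`-sets. -/
def homMk {X Y : RightSets M} (φ : X.pt → Y.pt) (h : ∀ x m, φ (X.act x m) = Y.act (φ x) m) :
    X ⟶ Y where
  app _ := ↾φ
  naturality _ _ m := ConcreteCategory.hom_ext _ _ fun x => h x m.unop

@[simp] lemma fn_homMk {X Y : RightSets M} (φ : X.pt → Y.pt)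
    (h : ∀ x m, φ (X.act x m) = Y.act (φ x) m) (x : X.pt) : fn (homMk φ h) x = φ x := rfl

@[simp] lemma ofAction_act {S : Type u} (a : S → M → S) (one : ∀ x, a x 1 = x)
    (mul : ∀ x m n, a x (m * n) = a (a x m) n) (x : S) (m : M) :
    (ofAction S a one mul).act x m = a x m := rfl

@[simp] lemma map_one_mul_map (f : M ⟶ N) (m : M) :
    MonS.Hom.hom f 1 * MonS.Hom.hom f m = MonS.Hom.hom f m := by rw [← map_mul, one_mul]

@[simp] lemma map_mul_map_one (f : M ⟶ N) (m : M) :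
    MonS.Hom.hom f m * MonS.Hom.hom f 1 = MonS.Hom.hom f m := by rw [← map_mul, mul_one]

/-- The restriction of a right `N`-set `X` along a semigroup homomorphism `f : M → N`:
the set `X · f(1) = {x | x · f(1) = x}` with `m` acting as `f(m)`. -/
def resObj (f : M ⟶ N) (X : RightSets N) : RightSets M :=
  ofAction {x : X.pt // X.act x (MonS.Hom.hom f 1) = x}
    (fun x m => ⟨X.act x.1 (MonS.Hom.hom f m), by rw [← act_mul, map_mul_map_one]⟩)
    (fun x => Subtype.ext x.2)
    (fun x m n => Subtype.ext
      ((congrArg (X.act x.1) (map_mul _ m n)).trans (act_mul _ _ _ _)))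

/-- Restriction along a semigroup homomorphism `f : M → N`. -/
def res (f : M ⟶ N) : RightSets N ⥤ RightSets M where
  obj X := resObj f X
  map φ := homMk (X := resObj f _) (Y := resObj f _)
    (fun x => ⟨fn φ x.1, by rw [← fn_act, x.2]⟩)
    (fun x m => Subtype.ext (fn_act φ x.1 _))
  map_id _ := hom_ext' fun _ => rfl
  map_comp _ _ := hom_ext' fun _ => rfl

/-- The `M`-equivariant maps `N · f(1) → Y`. -/
@[ext]
structure CoindSet (f : M ⟶ N) (Y : RightSets M) where
  /-- The underlying function. -/
  toFun : {n : N // n * MonS.Hom.hom f 1 = n} → Y.pt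
  equivariant (n : {n : N // n * MonS.Hom.hom f 1 = n}) (m : M) :
    toFun ⟨n.1 * MonS.Hom.hom f m, by rw [mul_assoc, map_mul_map_one]⟩ = Y.act (toFun n) m

/-- The right action `(h · k)(n) = h(k n)`. -/
def CoindSet.act {f : M ⟶ N} {Y : RightSets M} (h : CoindSet f Y) (k : N) : CoindSet f Y where
  toFun n := h.toFun ⟨k * n.1, by rw [mul_assoc, n.2]⟩
  equivariant n m :=
    (congrArg h.toFun (Subtype.ext (mul_assoc _ _ _).symm)).trans (h.equivariant _ m)

/-- The right adjoint of restriction along `f : M → N` on objects. -/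
def coindObj (f : M ⟶ N) (Y : RightSets M) : RightSets N :=
  ofAction (CoindSet f Y) CoindSet.act
    (fun h => CoindSet.ext (funext fun _ => congrArg h.toFun (Subtype.ext (one_mul _))))
    (fun h _ _ => CoindSet.ext (funext fun _ => congrArg h.toFun (Subtype.ext (mul_assoc _ _ _))))

/-- The right adjoint of restriction along `f : M → N`. -/
def coind (f : M ⟶ N) : RightSets M ⥤ RightSets N where
  obj Y := coindObj f Y
  map {X Y} φ := homMk (X := coindObj f X) (Y := coindObj f Y)
    (fun (h : CoindSet f X) => CoindSet.mk (fun n => fn φ (h.toFun n))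
      (fun n m => (congrArg (fn φ) (h.equivariant n m)).trans (fn_act φ _ _)))
    (fun _ _ => rfl)
  map_id _ := hom_ext' fun _ => rfl
  map_comp _ _ := hom_ext' fun _ => rfl

/-- The transpose of a morphism out of a restriction. -/
def toCoind (f : M ⟶ N) {X : RightSets N} {Y : RightSets M} (φ : resObj f X ⟶ Y) :
    X ⟶ coindObj f Y :=
  homMk (X := X) (Y := coindObj f Y)
    (fun x => CoindSet.mk (fun n => fn φ ⟨X.act x n.1, by rw [← act_mul, n.2]⟩)
      (fun n m => Eq.trans (congrArg (fn φ) (Subtype.ext (act_mul _ _ _ _))) (fn_act φ _ m)))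
    (fun x k => CoindSet.ext (funext fun n =>
      congrArg (fn φ) (Subtype.ext (act_mul _ _ _ _).symm)))

/-- The transpose of a morphism into a coinduced right set. -/
def ofCoind (f : M ⟶ N) {X : RightSets N} {Y : RightSets M} (ψ : X ⟶ coindObj f Y) :
    resObj f X ⟶ Y :=
  homMk (X := resObj f X) (Y := Y)
    (fun x => CoindSet.toFun (fn ψ x.1) ⟨MonS.Hom.hom f 1, map_mul_map_one f 1⟩)
    (fun x m => by
      refine (congrArg (fun h => CoindSet.toFun h _)
        (fn_act ψ x.1 (MonS.Hom.hom f m))).trans ?_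
      refine Eq.trans ?_ (CoindSet.equivariant (fn ψ x.1) _ m)
      exact congrArg (CoindSet.toFun (fn ψ x.1)) (Subtype.ext
        ((map_mul_map_one f m).trans (map_one_mul_map f m).symm)))

/-- Restriction is left adjoint to coinduction. -/
def resCoindAdj (f : M ⟶ N) : res f ⊣ coind f :=
  Adjunction.mkOfHomEquiv
    { homEquiv _ _ :=
        { toFun φ := toCoind f φ
          invFun ψ := ofCoind f ψ
          left_inv φ := hom_ext' fun x => congrArg (fn φ) (Subtype.ext x.2)
          right_inv ψ := hom_ext' fun x => CoindSet.ext (funext fun n =>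
            (congrArg (fun h => CoindSet.toFun h _) (fn_act ψ x n.1)).trans
              (congrArg (CoindSet.toFun (fn ψ x)) (Subtype.ext n.2))) }
      homEquiv_naturality_left_symm _ _ := hom_ext' fun _ => rfl
      homEquiv_naturality_right _ _ := hom_ext' fun _ => rfl }

/-- The relation `(y · m, n) ~ (y, f(m) n)` defining the tensor product over `M`. -/
inductive IndRel (f : M ⟶ N) (Y : RightSets M) :
    Y.pt × {n : N // MonS.Hom.hom f 1 * n = n} →
      Y.pt × {n : N // MonS.Hom.hom f 1 * n = n} → Prop
  | intro (y : Y.pt) (m : M) (n : {n : N // MonS.Hom.hom f 1 * n = n}) :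
      IndRel f Y (Y.act y m, n)
        (y, ⟨MonS.Hom.hom f m * n.1, by rw [← mul_assoc, map_one_mul_map]⟩)

/-- The tensor product `Y ⊗ f(1) · N` over `M`. -/
def IndSet (f : M ⟶ N) (Y : RightSets M) : Type u := Quot (IndRel f Y)

/-- The pure tensors. -/
def IndSet.mk {f : M ⟶ N} {Y : RightSets M} (y : Y.pt)
    (n : {n : N // MonS.Hom.hom f 1 * n = n}) : IndSet f Y :=
  Quot.mk _ (y, n)

lemma IndSet.mk_act {f : M ⟶ N} {Y : RightSets M} (y : Y.pt) (m : M)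
    (n : {n : N // MonS.Hom.hom f 1 * n = n}) :
    IndSet.mk (Y.act y m) n =
      IndSet.mk y ⟨MonS.Hom.hom f m * n.1, by rw [← mul_assoc, map_one_mul_map]⟩ :=
  Quot.sound (IndRel.intro y m n)

lemma IndSet.ind {f : M ⟶ N} {Y : RightSets M} {P : IndSet f Y → Prop}
    (h : ∀ y n, P (IndSet.mk y n)) (q : IndSet f Y) : P q :=
  Quot.ind (fun a => h a.1 a.2) q

/-- The universal property of the tensor product. -/
def IndSet.lift {f : M ⟶ N} {Y : RightSets M} {S : Type u}
    (F : Y.pt → {n : N // MonS.Hom.hom f 1 * n = n} → S)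
    (h : ∀ y m n, F (Y.act y m) n =
      F y ⟨MonS.Hom.hom f m * n.1, by rw [← mul_assoc, map_one_mul_map]⟩)
    (q : IndSet f Y) : S :=
  Quot.lift (fun a => F a.1 a.2) (fun _ _ r => by cases r; exact h _ _ _) q

/-- The right action of `N` on the second factor. -/
def IndSet.act {f : M ⟶ N} {Y : RightSets M} (q : IndSet f Y) (k : N) : IndSet f Y :=
  IndSet.lift (fun y n => IndSet.mk y ⟨n.1 * k, by rw [← mul_assoc, n.2]⟩)
    (fun y m n => (IndSet.mk_act y m _).trans
      (congrArg (IndSet.mk y) (Subtype.ext (mul_assoc _ _ _).symm))) q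

/-- The left adjoint of restriction along `f : M → N` on objects. -/
def indObj (f : M ⟶ N) (Y : RightSets M) : RightSets N :=
  ofAction (IndSet f Y) IndSet.act
    (IndSet.ind fun y _ => congrArg (IndSet.mk y) (Subtype.ext (mul_one _)))
    (fun q k l => IndSet.ind (P := fun q => q.act (k * l) = (q.act k).act l)
      (fun y _ => congrArg (IndSet.mk y) (Subtype.ext (mul_assoc _ _ _).symm)) q)

/-- Maps out of an induced right set, from those on pure tensors. -/
def indLift (f : M ⟶ N) {Y : RightSets M} {X : RightSets N}
    (F : Y.pt → {n : N // MonS.Hom.hom f 1 * n = n} → X.pt)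
    (h : ∀ y m n, F (Y.act y m) n =
      F y ⟨MonS.Hom.hom f m * n.1, by rw [← mul_assoc, map_one_mul_map]⟩)
    (h' : ∀ y n k, F y ⟨n.1 * k, by rw [← mul_assoc, n.2]⟩ = X.act (F y n) k) :
    indObj f Y ⟶ X :=
  homMk (X := indObj f Y) (Y := X) (IndSet.lift F h)
    (fun q k => IndSet.ind (P := fun q => IndSet.lift F h (q.act k) = X.act (IndSet.lift F h q) k)
      (fun y n => h' y n k) q)

lemma ind_hom_ext (f : M ⟶ N) {Y : RightSets M} {X : RightSets N} {φ ψ : indObj f Y ⟶ X}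
    (h : ∀ y n, fn φ (IndSet.mk y n) = fn ψ (IndSet.mk y n)) : φ = ψ :=
  hom_ext' (IndSet.ind h)

/-- The left adjoint of restriction along `f : M → N`. -/
def ind (f : M ⟶ N) : RightSets M ⥤ RightSets N where
  obj Y := indObj f Y
  map {_ Y} φ := indLift f (X := indObj f Y) (fun x n => IndSet.mk (fn φ x) n)
    (fun y m n => (congrArg (IndSet.mk · n) (fn_act φ y m)).trans (IndSet.mk_act _ m n))
    (fun _ _ _ => rfl)
  map_id _ := ind_hom_ext f fun _ _ => rfl
  map_comp _ _ := ind_hom_ext f fun _ _ => rfl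

/-- The transpose of a morphism out of an induced right set. -/
def toRes (f : M ⟶ N) {X : RightSets N} {Y : RightSets M} (φ : indObj f Y ⟶ X) :
    Y ⟶ resObj f X :=
  homMk (X := Y) (Y := resObj f X)
    (fun y => ⟨fn φ (IndSet.mk y ⟨MonS.Hom.hom f 1, map_one_mul_map f 1⟩),
      (fn_act φ _ _).symm.trans (congrArg (fn φ)
        (congrArg (IndSet.mk y) (Subtype.ext (map_mul_map_one f 1))))⟩)
    (fun y m => Subtype.ext (by
      refine Eq.trans ?_ (fn_act φ _ _)
      refine congrArg (fn φ) ((IndSet.mk_act y m _).trans ?_)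
      exact congrArg (IndSet.mk y)
        (Subtype.ext ((map_mul_map_one f m).trans (map_one_mul_map f m).symm))))

/-- The transpose of a morphism into a restriction. -/
def ofRes (f : M ⟶ N) {X : RightSets N} {Y : RightSets M} (ψ : Y ⟶ resObj f X) :
    indObj f Y ⟶ X :=
  indLift f (fun y n => X.act (Subtype.val (fn ψ y)) n.1)
    (fun y m n => (congrArg (fun z => X.act (Subtype.val z) n.1) (fn_act ψ y m)).trans
      (act_mul _ _ _ _).symm)
    (fun _ _ _ => act_mul _ _ _ _)

/-- Induction is left adjoint to restriction. -/
def indResAdj (f : M ⟶ N) : ind f ⊣ res f :=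
  Adjunction.mkOfHomEquiv
    { homEquiv _ _ :=
        { toFun φ := toRes f φ
          invFun ψ := ofRes f ψ
          left_inv φ := ind_hom_ext f fun y n =>
            (fn_act φ _ _).symm.trans
              (congrArg (fn φ) (congrArg (IndSet.mk y) (Subtype.ext n.2)))
          right_inv ψ := hom_ext' fun y => Subtype.ext (Subtype.property (fn ψ y)) }
      homEquiv_naturality_left_symm _ _ := ind_hom_ext f fun _ _ => rfl
      homEquiv_naturality_right _ _ := hom_ext' fun _ => rfl }

/-- The geometric morphism `[Mᵒᵖ, Set] ⟶ [Nᵒᵖ, Set]` induced by a semigroup homomorphism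
`f : M → N`; its inverse image is restriction along `f`. -/
def geom (f : M ⟶ N) : GeometricMorphism (RightSets M) (RightSets N) where
  directImage := coind f
  inverseImage := res f
  adj := resCoindAdj f
  preservesFiniteLimits :=
    have := (indResAdj f).isRightAdjoint
    inferInstance

lemma geom_isEssential (f : M ⟶ N) : (geom f).IsEssential := (indResAdj f).isRightAdjoint

/-- A conjugation `α : f ⇒ g` induces `x ↦ x · α` from restriction along `g` to restriction
along `f`. -/
def resMap {f g : M ⟶ N} (α : f ⟶ g) : res g ⟶ res f where
  app X := homMk (X := resObj g X) (Y := resObj f X)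
    (fun x => ⟨X.act x.1 α.elt, by rw [← act_mul, α.elt_mul]⟩)
    (fun x m => Subtype.ext (by
      exact (act_mul _ _ _ _).symm.trans
        ((congrArg (X.act x.1) (α.comm m).symm).trans (act_mul _ _ _ _))))
  naturality _ _ φ := hom_ext' fun x => Subtype.ext (fn_act φ x.1 _).symm

variable (M) in
/-- The canonical point of `[Mᵒᵖ, Set]`; its inverse image is the forgetful functor. -/
noncomputable def canonicalPoint : GeometricMorphism (Type u) (RightSets M) where
  directImage := evaluationRightAdjoint (Type u) (op (SingleObj.star M))
  inverseImage := (evaluation (SingleObj M)ᵒᵖ (Type u)).obj (op (SingleObj.star M))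
  adj := evaluationAdjunctionLeft (Type u) (op (SingleObj.star M))
  preservesFiniteLimits := inferInstance

variable (M) in
lemma canonicalPoint_isEssential : (canonicalPoint M).IsEssential :=
  (evaluationAdjunctionRight (Type u) (op (SingleObj.star M))).isRightAdjoint

variable (M) in
lemma canonicalPoint_isSurjective : (canonicalPoint M).IsSurjective := by
  have h : (canonicalPoint M).inverseImage.ReflectsIsomorphisms := by
    constructor
    intro X Y φ hφ
    rw [NatTrans.isIso_iff_isIso_app]
    exact fun _ => hφ
  have : PreservesLimitsOfSize.{0, 0} (canonicalPoint M).inverseImage :=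
    inferInstanceAs (PreservesLimitsOfSize.{0, 0}
     ((evaluation (SingleObj M)ᵒᵖ (Type u)).obj (op (SingleObj.star M))))
  have : Comonad.PreservesLimitOfIsCoreflexivePair (canonicalPoint M).inverseImage :=
    ⟨fun _ _ _ => inferInstance⟩
  exact ⟨Comonad.comonadicOfHasPreservesCoreflexiveEqualizersOfReflectsIsomorphisms
    (canonicalPoint M).adj⟩

variable (M) in
lemma isGrothendieckTopos : IsGrothendieckTopos (RightSets M) :=
  ⟨AsSmall.{u} (SingleObj M), inferInstance, ⊥,
    ⟨((AsSmall.equiv (C := SingleObj M)).op.congrLeft).trans (sheafBotEquivalence _).symm⟩⟩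

variable (M) in
/-- `[Mᵒᵖ, Set]` as a Grothendieck topos having an essential surjective point. -/
def topos : PointedTopos.{u} where
  carrier := RightSets M
  isGrothendieckTopos := isGrothendieckTopos M
  exists_point := ⟨canonicalPoint M, canonicalPoint_isEssential M, canonicalPoint_isSurjective M⟩

/-- Restriction along the identity is isomorphic to the identity. -/
def resId (M : MonS.{u}) : res (𝟙 M) ≅ 𝟭 (RightSets M) where
  hom :=
    { app X := homMk (X := resObj (𝟙 M) X) (Y := X) (fun x => x.1) (fun _ _ => rfl)
      naturality _ _ _ := hom_ext' fun _ => rfl }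
  inv :=
    { app X := homMk (X := X) (Y := resObj (𝟙 M) X) (fun x => ⟨x, X.act_one x⟩)
        (fun _ _ => rfl)
      naturality _ _ _ := hom_ext' fun _ => rfl }
  hom_inv_id := NatTrans.ext (funext fun _ => hom_ext' fun _ => rfl)
  inv_hom_id := NatTrans.ext (funext fun _ => hom_ext' fun _ => rfl)

/-- Restriction along a composite is isomorphic to the composite of the restrictions. -/
def resComp (f : M ⟶ N) (g : N ⟶ K) : res (f ≫ g) ≅ res g ⋙ res f where
  hom :=
    { app X := homMk (X := resObj (f ≫ g) X) (Y := resObj f (resObj g X))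
        (fun x => ⟨⟨x.1, by
          have h := x.2
          rw [← h, ← act_mul]
          refine congrArg (X.act x.1) ?_
          exact (map_mul (MonS.Hom.hom g) _ _).symm.trans (congrArg _ (mul_one _))⟩,
          Subtype.ext x.2⟩)
        (fun _ _ => rfl)
      naturality _ _ _ := hom_ext' fun _ => rfl }
  inv :=
    { app X := homMk (X := resObj f (resObj g X)) (Y := resObj (f ≫ g) X)
        (fun x => ⟨x.1.1, congrArg Subtype.val x.2⟩) (fun _ _ => rfl)
      naturality _ _ _ := hom_ext' fun _ => rfl }
  hom_inv_id := NatTrans.ext (funext fun _ => hom_ext' fun _ => rfl)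
  inv_hom_id := NatTrans.ext (funext fun _ => hom_ext' fun _ => rfl)

end RightSets

/-- The pseudofunctor `M ↦ [Mᵒᵖ, Set]`. -/
def presheafTopos : Co MonS.{u} ⥤ᵖ PointedTopos.{u} where
  obj M := RightSets.topos M.of
  map f := ⟨RightSets.geom f.of, RightSets.geom_isEssential f.of⟩
  map₂ η := ⟨RightSets.resMap η.of⟩
  map₂_id f := PointedTopos.hom₂_ext fun X =>
    RightSets.hom_ext' fun x => Subtype.ext (Subtype.property x)
  map₂_comp η θ := PointedTopos.hom₂_ext fun X =>
    RightSets.hom_ext' fun x => Subtype.ext (RightSets.act_mul _ _ _ _)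
  mapId M := PointedTopos.isoMk (RightSets.resId M.of)
  mapComp f g := PointedTopos.isoMk (RightSets.resComp f.of g.of)
  map₂_whisker_left f _ _ η := PointedTopos.hom₂_ext fun X =>
    RightSets.hom_ext' fun x => Subtype.ext
      ((congrArg (RightSets.act X x.1) (η.of.comm _)).trans
        ((RightSets.act_mul _ _ _ _).trans (congrArg (RightSets.act X · η.of.elt) x.2)))
  map₂_whisker_right η h := PointedTopos.hom₂_ext fun X => RightSets.hom_ext' fun x => rfl
  map₂_associator f g h := PointedTopos.hom₂_ext fun X =>
    RightSets.hom_ext' fun x => Subtype.ext x.2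
  map₂_left_unitor f := PointedTopos.hom₂_ext fun X =>
    RightSets.hom_ext' fun x => Subtype.ext x.2
  map₂_right_unitor f := PointedTopos.hom₂_ext fun X =>
    RightSets.hom_ext' fun x => Subtype.ext x.2

end MonoidTopos

/-!
Both halves of the statement use that an inverse image functor with a left adjoint is, on underlying
sets, of the form `Hom(Q, -)`, and that it is cocontinuous since it also has a right adjoint.

On hom-categories, the element `f(1)` of the regular right set is universal for the functor
`X ↦ X · f(1)`, so a natural transformation between restrictions is determined by the image of this
element, which is a conjugation (`RightSets.resMap_injective`, `RightSets.resMap_surjective`).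
Conversely, let `F` be an inverse image functor from right `N`-sets to right `M`-sets that has a
left adjoint. The underlying set of `F X` is `Hom(Q, X)` for a right `N`-set `Q` with a universal
element `u` in `F Q` (`RightSets.exists_universal_element`). Since `F` also has a right adjoint, it
preserves the covering of `Q` by the orbit maps `N ⟶ Q` from the regular right set, so `u` lifts
along one of them
(`RightSets.exists_orbit_of_leftAdjoint`). The lift is an element of `F N`, that is, a section of
this orbit map; thus `Q` is a retract `e N` of the regular right set for an idempotent `e`. The
action of `M` on `u` is a homomorphism from `M` to `End Q`, which is `e N e`, and composed with the
inclusion in `N` it is a semigroup homomorphism along which `F` is restriction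
(`RightSets.exists_res_iso`).

On objects, let `p` be an essential surjective point of a topos `E`. Its inverse image is
`Hom(P, -)` for some `P`; it is cocontinuous because it has a right adjoint, and conservative
because it is comonadic. The functor from `E` to the right `End P`-sets that lifts it is then an
equivalence: the unit of its adjunction with the Yoneda extension of `P` is a transformation between
cocontinuous functors, invertible on the representable presheaf and so everywhere, and the counit is
invertible by conservativity (`isEquivalence_restrictedULiftYoneda`).
-/

namespace MonoidTopos

open CategoryTheory Bicategory Opposite Limits

/-! ### Elements of right sets -/

namespace RightSets

variable {M N : MonS.{u}}

lemma isIso_of_bijective {X Y : RightSets M} (φ : X ⟶ Y) (h : Function.Bijective (fn φ)) :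
    IsIso φ := by
  rw [NatTrans.isIso_iff_isIso_app]
  exact fun _ => (isIso_iff_bijective _).2 h

variable (M) in
/-- The right regular right `M`-set. -/
def regular : RightSets M :=
  ofAction M (fun n m => n * m) mul_one (fun _ _ _ => (mul_assoc _ _ _).symm)

variable (M) in
/-- The generator of the right regular right `M`-set. -/
def gen : (regular M).pt := (1 : M)

/-- The morphism out of the right regular right `M`-set that sends the generator to `x`. -/
def orbit (X : RightSets M) (x : X.pt) : regular M ⟶ X :=
  homMk (X := regular M) (Y := X) (fun m => X.act x m) (fun _ _ => act_mul _ _ _ _)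

@[simp] lemma fn_orbit_gen (X : RightSets M) (x : X.pt) : fn (orbit X x) (gen M) = x :=
  act_one X x

lemma gen_act (x : (regular M).pt) : (regular M).act (gen M) x = x :=
  one_mul (M := M) x

lemma hom_ext_gen {X : RightSets M} {φ ψ : regular M ⟶ X}
    (h : fn φ (gen M) = fn ψ (gen M)) : φ = ψ :=
  hom_ext' fun m => (congrArg (fn φ) (gen_act m).symm).trans ((fn_act φ _ _).trans
    ((congrArg (X.act · m) h).trans ((fn_act ψ _ _).symm.trans (congrArg (fn ψ) (gen_act m)))))

lemma orbit_comp {X Y : RightSets M} (x : X.pt) (φ : X ⟶ Y) :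
    orbit X x ≫ φ = orbit Y (fn φ x) :=
  hom_ext_gen (by simp)

/-! ### Natural transformations between restrictions -/

/-- The universal element `f(1)` of the functor `X ↦ X · f(1)`. -/
def resGen (f : M ⟶ N) : ((res f).obj (regular N)).pt :=
  (⟨MonS.Hom.hom f 1, map_mul_map_one f 1⟩ : {x : N // x * MonS.Hom.hom f 1 = x})

lemma resMap_injective {f g : M ⟶ N} {α β : f ⟶ g} (h : resMap α = resMap β) : α = β := by
  apply MonS.hom₂_ext
  have h₁ := congrArg (fun θ : res g ⟶ res f =>
    Subtype.val (fn (θ.app (regular N)) (resGen g))) h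
  exact (MonS.Conjugation.mul_elt α).symm.trans (h₁.trans (MonS.Conjugation.mul_elt β))

lemma resMap_surjective {f g : M ⟶ N} (θ : res g ⟶ res f) : ∃ α : f ⟶ g, resMap α = θ := by
  -- A conjugation is recovered as the image of the universal element.
  let b : ((res f).obj (regular N)).pt := fn (θ.app (regular N)) (resGen g)
  let a : N := Subtype.val b
  have key (X : RightSets N) (x : (resObj g X).pt) :
      Subtype.val (fn (θ.app X) x) = X.act x.1 a := by
    have h := congrArg (fun φ => Subtype.val (fn φ (resGen g))) (θ.naturality (orbit X x.1))
    refine Eq.trans ?_ h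
    exact congrArg (fun y => Subtype.val (fn (θ.app X) y)) (Subtype.ext x.2.symm)
  have comm (m : M) : a * MonS.Hom.hom f m = MonS.Hom.hom g m * a := by
    have h := congrArg Subtype.val (fn_act (θ.app (regular N)) (resGen g) m)
    refine h.symm.trans ((key _ _).trans ?_)
    exact congrArg (· * a) (map_one_mul_map g m)
  have ha : a * MonS.Hom.hom f 1 = a := Subtype.property b
  refine ⟨⟨a, ha, (comm 1).symm.trans ha, comm⟩, ?_⟩
  exact NatTrans.ext (funext fun X => hom_ext' fun x => Subtype.ext (key X x).symm)

/-! ### Functors with adjoints on both sides -/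

/-- The cofree right `M`-set on the set of truth values: the predicates on `M`, translated. -/
def predicates (M : MonS.{u}) : RightSets M :=
  ofAction (ULift.{u} (M → Prop)) (fun p m => ⟨fun n => p.down (m * n)⟩)
    (fun p => by simp) (fun p m n => by simp [mul_assoc])

/-- A right `N`-set is covered by the orbit maps of its elements, and a left adjoint preserves
this covering. -/
lemma exists_orbit_of_leftAdjoint {F : RightSets N ⥤ RightSets M} {G : RightSets M ⥤ RightSets N}
    (adj : F ⊣ G) (Q : RightSets N) (y : (F.obj Q).pt) :
    ∃ (q : Q.pt) (z : (F.obj (regular N)).pt), fn (F.map (orbit Q q)) z = y := by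
  let S (y : (F.obj Q).pt) : Prop :=
    ∃ (q : Q.pt) (z : (F.obj (regular N)).pt), fn (F.map (orbit Q q)) z = y
  let a : F.obj Q ⟶ predicates M :=
    homMk (X := F.obj Q) (Y := predicates M) (fun y => ⟨fun n => S ((F.obj Q).act y n)⟩)
      (fun y m => congrArg ULift.up (funext fun n =>
        congrArg S (act_mul (F.obj Q) y m n).symm))
  let b : F.obj Q ⟶ predicates M :=
    homMk (X := F.obj Q) (Y := predicates M) (fun _ => ⟨fun _ => True⟩) (fun _ _ => rfl)
  -- `a` and `b` agree on the union `S` of the images, so their transposes agree on all orbits.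
  have h (q : Q.pt) : F.map (orbit Q q) ≫ a = F.map (orbit Q q) ≫ b :=
    hom_ext' fun z => congrArg ULift.up (funext fun n =>
      eq_true ⟨q, (F.obj (regular N)).act z n, fn_act _ _ _⟩)
  have hab : a = b := by
    apply (adj.homEquiv _ _).injective
    refine hom_ext' fun q => ?_
    have hq : orbit Q q ≫ adj.homEquiv _ _ a = orbit Q q ≫ adj.homEquiv _ _ b := by
      rw [← adj.homEquiv_naturality_left, ← adj.homEquiv_naturality_left, h]
    simpa using congrArg (fun φ => fn φ (gen N)) hq
  have h₁ : S ((F.obj Q).act y 1) :=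
    of_eq_true (congrFun (congrArg ULift.down (congrArg (fun φ => fn φ y) hab)) 1)
  rwa [act_one] at h₁

/-- The underlying functor of a right adjoint is represented by the image of the regular right
set under the left adjoint. -/
lemma exists_universal_element {L : RightSets M ⥤ RightSets N} {F : RightSets N ⥤ RightSets M}
    (adj : L ⊣ F) : ∃ (Q : RightSets N) (u : (F.obj Q).pt),
      ∀ (X : RightSets N) (y : (F.obj X).pt), ∃! h : Q ⟶ X, fn (F.map h) u = y := by
  let η : regular M ⟶ F.obj (L.obj (regular M)) := adj.unit.app (regular M)
  refine ⟨L.obj (regular M), fn η (gen M), fun X y => ?_⟩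
  have key (h : L.obj (regular M) ⟶ X) :
      fn (F.map h) (fn η (gen M)) = y ↔ adj.homEquiv _ _ h = orbit _ y := by
    have e : adj.homEquiv _ _ h = η ≫ F.map h := adj.homEquiv_unit ..
    rw [e]
    refine ⟨fun e => hom_ext_gen (by simp [e]), fun e => ?_⟩
    rw [← fn_comp, e, fn_orbit_gen]
  refine ⟨(adj.homEquiv _ _).symm (orbit _ y), ?_, fun h hh => ?_⟩
  · simp only [key, Equiv.apply_symm_apply]
  · exact (Equiv.eq_symm_apply _).2 ((key h).1 hh)

/-- A functor between categories of right sets with adjoints on both sides is restriction along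
a semigroup homomorphism. The right adjoint makes the object `Q` representing its underlying
functor a retract of the regular right set, and the action of `M` on the universal element is
the homomorphism to the endomorphisms of `Q`. -/
lemma exists_res_iso {L : RightSets M ⥤ RightSets N} {F : RightSets N ⥤ RightSets M}
    {G : RightSets M ⥤ RightSets N} (adj₁ : L ⊣ F) (adj₂ : F ⊣ G) :
    ∃ f : M ⟶ N, Nonempty (res f ≅ F) := by
  obtain ⟨Q, u, hu⟩ := exists_universal_element adj₁
  obtain ⟨q, z, hz⟩ := exists_orbit_of_leftAdjoint adj₂ Q u
  have ext {X : RightSets N} {a b : Q ⟶ X} (e : fn (F.map a) u = fn (F.map b) u) : a = b :=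
    (hu X _).unique e rfl
  -- `h` is a section of the orbit map of `q`, with underlying function `s`.
  obtain ⟨h, hh, -⟩ := hu (regular N) z
  let s (w : Q.pt) : N := fn h w
  have orbit_s {X : RightSets N} (x : X.pt) (w : Q.pt) :
      fn (h ≫ orbit X x) w = X.act x (s w) := rfl
  have s_act (w : Q.pt) (n : N) : s (Q.act w n) = s w * n := fn_act h w n
  have hsec : h ≫ orbit Q q = 𝟙 Q := ext (by simp [hh, hz])
  have act_s (w : Q.pt) : Q.act q (s w) = w := congrArg (fun φ => fn φ w) hsec
  -- `k m` represents the action of `m`, and `t X y` classifies `y`.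
  choose k hk using fun m : M => (hu Q ((F.obj Q).act u m)).exists
  choose t ht using fun (X : RightSets N) (y : (F.obj X).pt) => (hu X y).exists
  have k_mul (m n : M) : k (m * n) = k n ≫ k m := ext (by
    rw [hk, F.map_comp, fn_comp, hk, fn_act, hk, act_mul])
  have k_one : k 1 = 𝟙 Q := ext (by rw [hk, act_one, F.map_id, fn_id])
  let c (m : M) : N := s (fn (k m) q)
  have c_mul_s (m : M) (w : Q.pt) : c m * s w = s (fn (k m) w) := by
    rw [← s_act, ← fn_act, act_s]
  let f : M ⟶ N := ⟨⟨c, fun m n => by rw [c_mul_s, ← fn_comp, ← k_mul]⟩⟩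
  have c_one : c 1 = s q := by simp only [c, k_one, fn_id]
  have orbit_z {X : RightSets N} (x : X.pt) :
      fn (F.map (orbit X x)) z = fn (F.map (h ≫ orbit X x)) u := by
    rw [F.map_comp, fn_comp, hh]
  let τ : res f ⟶ F :=
    { app X := homMk (X := resObj f X) (Y := F.obj X) (fun x => fn (F.map (orbit X x.1)) z)
        (fun x m => by
          rw [orbit_z, orbit_z, ← fn_act, ← hk, ← fn_comp, ← F.map_comp]
          congr 2
          refine hom_ext' fun w => ?_
          refine (act_mul X x.1 (c m) (s w)).symm.trans ?_
          rw [c_mul_s]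
          rfl)
      naturality X Y φ := hom_ext' fun x => by
        change fn (F.map (orbit Y (fn φ x.1))) z = fn (F.map φ) (fn (F.map (orbit X x.1)) z)
        rw [← orbit_comp, F.map_comp, fn_comp] }
  have τ_bij (X : RightSets N) : Function.Bijective (fn (τ.app X)) := by
    refine Function.bijective_iff_has_inverse.2 ⟨fun y => ⟨fn (t X y) q, ?_⟩,
      fun x => Subtype.ext ?_, fun y => ?_⟩
    · change X.act (fn (t X y) q) (c 1) = fn (t X y) q
      rw [c_one, ← fn_act, act_s]
    · have e : t X (fn (τ.app X) x) = h ≫ orbit X x.1 := ext (by rw [ht, ← orbit_z]; rfl)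
      change fn (t X (fn (τ.app X) x)) q = x.1
      rw [e, orbit_s, ← c_one]
      exact x.2
    · change fn (F.map (orbit X (fn (t X y) q))) z = y
      rw [← orbit_comp, F.map_comp, fn_comp, hz, ht]
  have (X : RightSets N) : IsIso (τ.app X) := isIso_of_bijective _ (τ_bij X)
  have : IsIso τ := NatIso.isIso_of_isIso_app τ
  exact ⟨f, ⟨asIso τ⟩⟩

end RightSets

/-! ### The equivalences of hom-categories -/

lemma isEquivalence_mapFunctor_presheafTopos (M N : Co MonS.{u}) :
    (presheafTopos.{u}.toPrelaxFunctor.mapFunctor M N).IsEquivalence where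
  faithful := ⟨fun h => Co.Hom₂.ext
    (RightSets.resMap_injective (congrArg PointedTopos.Hom₂.nat h))⟩
  full := ⟨fun θ => by
    obtain ⟨α, hα⟩ := RightSets.resMap_surjective (PointedTopos.Hom₂.nat θ)
    exact ⟨⟨α⟩, PointedTopos.Hom₂.ext hα⟩⟩
  essSurj := ⟨fun φ => by
    have : (PointedTopos.Hom.geom φ).inverseImage.IsRightAdjoint :=
      PointedTopos.Hom.isEssential φ
    obtain ⟨f, ⟨e⟩⟩ := RightSets.exists_res_iso
      (Adjunction.ofIsRightAdjoint (PointedTopos.Hom.geom φ).inverseImage)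
      (PointedTopos.Hom.geom φ).adj
    exact ⟨⟨f⟩, ⟨PointedTopos.isoMk e⟩⟩⟩

/-! ### Equivalences with presheaf categories -/

section

universe u₁

variable {C : Type u₁} [Category.{u} C] {D : Type v} [Category.{w} D]

/-- Invertibility of a transformation between cocontinuous functors on presheaves can be checked on
representables, since every presheaf is a colimit of these. -/
lemma isIso_of_isIso_app_uliftYoneda {F G : (Cᵒᵖ ⥤ Type u) ⥤ D}
    [PreservesColimitsOfSize.{u, max u₁ u} F] [PreservesColimitsOfSize.{u, max u₁ u} G] (τ : F ⟶ G)
    (h : ∀ X : C, IsIso (τ.app (uliftYoneda.{u}.obj X))) : IsIso τ := by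
  rw [NatTrans.isIso_iff_isIso_app]
  intro P
  have hP := Presheaf.isColimitTautologicalCocone'.{u} P
  have hF := isColimitOfPreserves F hP
  have hG := isColimitOfPreserves G hP
  have (j : CostructuredArrow (uliftYoneda.{u} (C := C)) P) :
      IsIso (τ.app ((CostructuredArrow.proj uliftYoneda.{u} P ⋙ uliftYoneda.{u}).obj j)) := h _
  let e : F.obj P ≅ G.obj P := hF.coconePointsIsoOfNatIso hG
    (NatIso.ofComponents (fun j => asIso (τ.app
      ((CostructuredArrow.proj uliftYoneda.{u} P ⋙ uliftYoneda.{u}).obj j)))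
      (fun _ => τ.naturality _))
  have : τ.app P = e.hom := hF.hom_ext fun j => by
    refine Eq.trans ?_ (IsColimit.comp_coconePointsIsoOfNatIso_hom hF hG _ j).symm
    exact τ.naturality _
  rw [this]
  infer_instance

/-- If the nerve of a fully faithful functor is cocontinuous and conservative, then it is an
equivalence: its left adjoint is the Kan extension of the functor along the Yoneda embedding, the
unit is invertible on representables and hence everywhere, and the counit is then invertible by
conservativity. -/
lemma isEquivalence_restrictedULiftYoneda {E : Type v} [Category.{u} E]
    [HasColimitsOfSize.{u, max u₁ u} E] (A : C ⥤ E) [A.Full] [A.Faithful]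
    [PreservesColimitsOfSize.{u, max u₁ u} (Presheaf.restrictedULiftYoneda.{u} A)]
    [(Presheaf.restrictedULiftYoneda.{u} A).ReflectsIsomorphisms] :
    (Presheaf.restrictedULiftYoneda.{u} A).IsEquivalence := by
  have : (uliftYoneda.{u} (C := C)).HasPointwiseLeftKanExtension A := fun Y =>
    (inferInstance : HasColimit (CostructuredArrow.proj uliftYoneda.{u} Y ⋙ A))
  let L := (uliftYoneda.{u}).leftKanExtension A
  let α : A ⟶ uliftYoneda.{u} ⋙ L := (uliftYoneda.{u}).leftKanExtensionUnit A
  let adj := Presheaf.uliftYonedaAdjunction.{u} L α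
  have : PreservesColimitsOfSize.{u, max u₁ u} L := adj.leftAdjoint_preservesColimits
  have : IsIso adj.unit := isIso_of_isIso_app_uliftYoneda _ fun X => by
    rw [NatTrans.isIso_iff_isIso_app]
    intro Z
    rw [isIso_iff_bijective]
    have hα : IsIso α := inferInstance
    have key (z : (uliftYoneda.{u}.obj X).obj Z) :
        (adj.unit.app (uliftYoneda.{u}.obj X)).app Z z = ULift.up (A.map z.down ≫ α.app X) := by
      refine (Presheaf.uliftYonedaAdjunction_unit_app_app L α _ z).trans ?_
      rw [α.naturality]
      rfl
    refine ⟨fun z w h => ?_, fun y => ?_⟩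
    · rw [key, key] at h
      exact ULift.ext _ _ (A.map_injective ((cancel_mono (α.app X)).1 (ULift.up_injective h)))
    · let z : A.obj Z.unop ⟶ L.obj (uliftYoneda.{u}.obj X) := ULift.down y
      refine ⟨ULift.up (A.preimage (z ≫ inv (α.app X))), (key _).trans (congrArg ULift.up ?_)⟩
      change A.map (A.preimage (z ≫ inv (α.app X))) ≫ α.app X = z
      simp
  have : IsIso adj.counit := by
    rw [NatTrans.isIso_iff_isIso_app]
    intro X
    have : IsIso ((Presheaf.restrictedULiftYoneda.{u} A).map (adj.counit.app X)) :=
      have := adj.right_triangle_components X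
      IsIso.of_isIso_fac_left this
    exact isIso_of_reflects_iso _ (Presheaf.restrictedULiftYoneda.{u} A)
  exact adj.toEquivalence.isEquivalence_inverse

end

/-! ### Toposes with an essential surjective point -/

section

variable {E : Type v} [Category.{u} E] (P : E)

/-- The inclusion in `E` of the full subcategory on `P`. Composition in `SingleObj` and
multiplication in `End` both reverse the diagrammatic order, so the identity is covariant. -/
def endInclusion : SingleObj (End P) ⥤ E := SingleObj.functor (MonoidHom.id (End P))

instance : (endInclusion P).Full := ⟨fun f => ⟨f, rfl⟩⟩

instance : (endInclusion P).Faithful := ⟨fun h => h⟩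

/-- If `Hom(P, -)` is cocontinuous and conservative, then it lifts to an equivalence onto the right
`End P`-sets. -/
lemma isEquivalence_restrictedULiftYoneda_endInclusion [HasColimitsOfSize.{u, u} E]
    [PreservesColimitsOfSize.{u, u} (coyoneda.obj (op P))]
    [(coyoneda.obj (op P)).ReflectsIsomorphisms] :
    (Presheaf.restrictedULiftYoneda.{u} (endInclusion P)).IsEquivalence := by
  let R := Presheaf.restrictedULiftYoneda.{u} (endInclusion P)
  have hR (k : (SingleObj (End P))ᵒᵖ) : R ⋙ (evaluation _ _).obj k ≅
      coyoneda.obj (op P) ⋙ uliftFunctor.{u} := Iso.refl _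
  have : PreservesColimitsOfSize.{u, u} R := preservesColimits_of_evaluation _ fun k =>
    preservesColimits_of_natIso (hR k).symm
  have : R.ReflectsIsomorphisms := ⟨fun {X Y} f hf => by
    have h : IsIso ((R ⋙ (evaluation _ _).obj (op (SingleObj.star _))).map f) :=
      inferInstanceAs (IsIso (((evaluation _ _).obj (op (SingleObj.star _))).map (R.map f)))
    rw [NatIso.isIso_map_iff (hR _)] at h
    exact isIso_of_reflects_iso _ (coyoneda.obj (op P) ⋙ uliftFunctor.{u})⟩
  exact isEquivalence_restrictedULiftYoneda _

end

lemma reflectsIsomorphisms_of_comonadic {C : Type*} [Category C] {D : Type*} [Category D]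
    (F : C ⥤ D) [ComonadicLeftAdjoint F] : F.ReflectsIsomorphisms :=
  reflectsIsomorphisms_of_iso (Comonad.comparisonForget (comonadicAdjunction F))

/-- A right adjoint to sets is represented by the image of the one-point set under the left
adjoint. -/
def coyonedaIsoOfAdjunction {E : Type v} [Category.{u} E] {F : E ⥤ Type u} {L : Type u ⥤ E}
    (adj : L ⊣ F) : coyoneda.obj (op (L.obj PUnit)) ≅ F :=
  NatIso.ofComponents (fun X => (adj.homEquiv PUnit X).toIso)
    (fun f => ConcreteCategory.hom_ext _ _ fun g => adj.homEquiv_naturality_right g f) ≪≫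
    Functor.isoWhiskerLeft F Coyoneda.punitIso ≪≫ F.rightUnitor

/-- An equivalence of categories as an essential geometric morphism. -/
def PointedTopos.homOfEquivalence {E F : PointedTopos.{u}} (e : E.carrier ≌ F.carrier) :
    E ⟶ F where
  geom :=
    { directImage := e.functor
      inverseImage := e.inverse
      adj := e.symm.toAdjunction
      preservesFiniteLimits := inferInstance }
  isEssential := e.toAdjunction.isRightAdjoint

lemma PointedTopos.nonempty_equivalence {E F : PointedTopos.{u}} (e : E.carrier ≌ F.carrier) :
    Nonempty (Bicategory.Equivalence E F) :=
  ⟨Equivalence.mkOfAdjointifyCounit (f := homOfEquivalence e) (g := homOfEquivalence e.symm)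
    (isoMk e.unitIso) (isoMk e.counitIso)⟩

/-- The monoid is that of endomorphisms of the object representing the inverse image functor of the
point. -/
lemma PointedTopos.exists_equivalence (E : PointedTopos.{u}) :
    ∃ M : MonS.{u}, Nonempty (RightSets M ≌ E.carrier) := by
  obtain ⟨p, hp, ⟨hp'⟩⟩ := E.exists_point
  obtain ⟨C, _, J, ⟨e⟩⟩ := E.isGrothendieckTopos
  have : HasColimitsOfSize.{u, u} E.carrier :=
    have : HasColimitsOfSize.{u, u} (Sheaf J (Type u)) :=
      hasColimits_of_reflective (sheafToPresheaf J (Type u))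
    Adjunction.has_colimits_of_equivalence e.functor
  have : p.inverseImage.IsRightAdjoint := hp
  let i := coyonedaIsoOfAdjunction (Adjunction.ofIsRightAdjoint p.inverseImage)
  -- The inverse image is cocontinuous, and conservative since it is comonadic.
  have := p.adj.leftAdjoint_preservesColimits
  have := preservesColimits_of_natIso i.symm
  have := reflectsIsomorphisms_of_comonadic p.inverseImage
  have := reflectsIsomorphisms_of_iso i.symm
  have := isEquivalence_restrictedULiftYoneda_endInclusion (p.inverseImage.leftAdjoint.obj PUnit)
  exact ⟨⟨End (p.inverseImage.leftAdjoint.obj PUnit)⟩, ⟨(Functor.asEquivalence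
    (Presheaf.restrictedULiftYoneda.{u} (endInclusion _))).symm⟩⟩

end MonoidTopos

theorem mainTheorem2 :
    MonoidTopos.IsTwoEquivalence MonoidTopos.presheafTopos.{u} where
  essSurj E := by
    obtain ⟨M, ⟨e⟩⟩ := MonoidTopos.PointedTopos.exists_equivalence E
    exact ⟨⟨M⟩, MonoidTopos.PointedTopos.nonempty_equivalence
      (E := MonoidTopos.RightSets.topos M) e⟩
  isEquivalence_mapFunctor := MonoidTopos.isEquivalence_mapFunctor_presheafTopos
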